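/- Let $X$ be a Hausdorff topological space. Let $\Xi\subseteq X$ be the union of a (possibly infinite) family of pairwise disjoint open subsets of $X$, each of which, with the subspace topology, is homeomorphic to the open interval $(0,1)$, and let $Z=X\setminus\Xi$ with the subspace topology. A loop in a space $Y$ is a continuous map $S^1\to Y$; two loops $\gamma,\gamma'$ in $Y$ are freely homotopic in $Y$ if there is a continuous map $S^1\times[0,1]\to Y$ which restricts to $\gamma$ on $S^1\times\{0\}$ and to $\gamma'$ on $S^1\times\{1\}$; a loop is nulhomotopic in $Y$ if it is freely homotopic in $Y$ to a constant loop, and essential in $Y$ otherwise. Let $B^2$ be the closed unit disc. (1) For every continuous map $g\colon B^2\to X$ with $g(\partial B^2)\subseteq Z$ there is a continuous map $g'\colon B^2\to Z$ with $g'|_{\partial B^2}=g|_{\partial B^2}$. Likewise, every loop in $Z$ that is nulhomotopic in $X$ is nulhomotopic in $Z$; that is, a loop that is essential in $Z$ remains essential in $X$. (2) If $\gamma$ and $\gamma'$ are loops in $Z$ that are essential in $Z$ and freely homotopic in $X$, then they are freely homotopic in $Z$. -/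

import Mathlib

/-- `ξ` is an open subset of `X` which, with the subspace topology, is homeomorphic to an open
arc, that is, to the open interval `(0, 1)`. -/
def IsOpenArc {X : Type*} [TopologicalSpace X] (ξ : Set X) : Prop :=
  IsOpen ξ ∧ Nonempty (ξ ≃ₜ Set.Ioo (0 : ℝ) 1)

/-- The closed unit disc `B²`; its boundary circle consists of the points of norm one. -/
abbrev ClosedDisc : Type := Metric.closedBall (0 : ℂ) 1

/-- A loop `S¹ → Z` in a subspace `Z` of `X`, considered as a loop in `X`. -/
noncomputable def loopInAmbient {X : Type*} [TopologicalSpace X] {Z : Set X} (γ : C(Circle, Z)) :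
    C(Circle, X) :=
  (ContinuousMap.mk Subtype.val continuous_subtype_val).comp γ

/-- A loop is essential if it is not freely homotopic to a constant loop. -/
def EssentialLoop {Y : Type*} [TopologicalSpace Y] (γ : C(Circle, Y)) : Prop :=
  ¬ γ.Nullhomotopic

open Set Filter Topology

/-! ### Frontiers of components of open sets -/

section Frontier

variable {B : Type*} [TopologicalSpace B]

/-! Let `g : B → X` send `S` into `Z`. Call a closed `A ⊇ S` admissible if `g` is constant on the
frontier of each component of `Aᶜ`; replacing `g` by that constant on each component gives a
continuous map (`ConstOnFrontiers.exists_collapse`). Admissibility passes to intersections of chains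
(`ConstOnFrontiers.sInter`), so Zorn gives a minimal `A`, which treats all arcs at once. Let `h` be
its collapse.

An arc coordinate is a map `X → ℝ/ℤ` vanishing exactly off the arc. If its composite with `h` lifts
to a real `F` vanishing on `S`, then `A ∩ {F = 0}` is again admissible
(`ConstOnFrontiers.inter_lift`), so by minimality `F = 0` on `A` and `h` misses the arc.

On a disc such a lift always exists. On a cylinder the lift that is `0` at one end is a constant
integer at the other; if this is nonzero, cutting the homotopy off where `F` leaves `0` contracts
the first loop in `X`, hence in `Z` by the disc case. -/

theorem IsPreconnected.inter_frontier_nonempty_of_isOpen {N C : Set B} (hN : IsPreconnected N)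
    (hC : IsOpen C) (h₁ : (N ∩ C).Nonempty) {y : B} (hy : y ∈ N) (hyC : y ∉ C) :
    (N ∩ frontier C).Nonempty := by
  by_contra h
  refine hyC (hN.subset_of_closure_inter_subset hC h₁ (fun z hz => ?_) hy)
  by_contra hzC
  exact h ⟨z, hz.2, by rw [hC.frontier_eq]; exact ⟨hz.1, hzC⟩⟩

theorem notMem_of_mem_frontier_connectedComponentIn [LocallyConnectedSpace B] {U : Set B}
    (hU : IsOpen U) {x y : B} (hy : y ∈ frontier (connectedComponentIn U x)) : y ∉ U := by
  intro hyU
  rw [hU.connectedComponentIn.frontier_eq] at hy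
  obtain ⟨z, hz, hz'⟩ := mem_closure_iff.1 hy.1 _ hU.connectedComponentIn
    (mem_connectedComponentIn hyU)
  apply hy.2
  rw [connectedComponentIn_eq hz', ← connectedComponentIn_eq hz]
  exact mem_connectedComponentIn hyU

end Frontier

/-! ### Collapsing complementary components -/

section Collapse

variable {B X : Type*} [TopologicalSpace B] [TopologicalSpace X]

/-- `g` is constant on the frontier of each connected component of the complement of `A`. -/
def ConstOnFrontiers (g : B → X) (A : Set B) : Prop :=
  ∀ x ∉ A, ∀ y ∈ frontier (connectedComponentIn Aᶜ x),
    ∀ z ∈ frontier (connectedComponentIn Aᶜ x), g y = g z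

/-- Continuity at a point of `A`: a small connected neighbourhood that meets a component of `Aᶜ`
also meets its frontier, where `g` already takes the value assigned to the component. -/
theorem ConstOnFrontiers.exists_collapse [LocallyConnectedSpace B] [PreconnectedSpace B]
    {g : C(B, X)} {A : Set B} (hA : IsClosed A) (hne : A.Nonempty) (h : ConstOnFrontiers g A) :
    ∃ g' : C(B, X), EqOn g' g A ∧ (∀ x, ∃ y ∈ A, g' x = g y) ∧
      ∀ x ∉ A, ∀ y ∈ connectedComponentIn Aᶜ x, g' y = g' x := by
  classical
  have hfr : ∀ x, x ∉ A → (frontier (connectedComponentIn Aᶜ x)).Nonempty := by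
    intro x hx
    obtain ⟨a, ha⟩ := hne
    refine nonempty_frontier_iff.2 ⟨⟨x, mem_connectedComponentIn hx⟩, fun hu => ?_⟩
    exact connectedComponentIn_subset Aᶜ x (hu ▸ mem_univ a) ha
  choose p hp using hfr
  have hpA : ∀ x hx, p x hx ∈ A := fun x hx =>
    not_not.1 (notMem_of_mem_frontier_connectedComponentIn hA.isOpen_compl (hp x hx))
  let f : B → X := fun x => if hx : x ∈ A then g x else g (p x hx)
  have hfA : ∀ x, x ∈ A → f x = g x := fun x hx => dif_pos hx
  have hfC : ∀ x (hx : x ∉ A), f x = g (p x hx) := fun x hx => dif_neg hx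
  have hconst : ∀ x ∉ A, ∀ y ∈ connectedComponentIn Aᶜ x, f y = f x := by
    intro x hx y hy
    have hyA : y ∉ A := connectedComponentIn_subset Aᶜ x hy
    rw [hfC x hx, hfC y hyA]
    refine h x hx _ ?_ _ (hp x hx)
    rw [connectedComponentIn_eq hy]
    exact hp y hyA
  have hcont : Continuous f := by
    refine continuous_iff_continuousAt.2 fun x => ?_
    by_cases hx : x ∈ A
    · intro O hO
      rw [hfA x hx] at hO
      have hN := connectedComponentIn_mem_nhds (g.continuous.continuousAt hO)
      rw [mem_map]
      refine mem_of_superset hN fun y hy => ?_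
      by_cases hyA : y ∈ A
      · rw [mem_preimage, hfA y hyA]
        exact connectedComponentIn_subset (g ⁻¹' O) _ hy
      · obtain ⟨z, hzN, hz⟩ :=
          (isPreconnected_connectedComponentIn (F := g ⁻¹' O) (x := x)).inter_frontier_nonempty_of_isOpen
          (hA.isOpen_compl.connectedComponentIn (x := y))
          ⟨y, hy, mem_connectedComponentIn hyA⟩ (mem_of_mem_nhds hN)
          (fun hc => connectedComponentIn_subset _ _ hc hx)
        rw [mem_preimage, hfC y hyA, h y hyA _ (hp y hyA) z hz]
        exact connectedComponentIn_subset (g ⁻¹' O) _ hzN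
    · refine (continuousAt_const (y := f x)).congr ?_
      filter_upwards [connectedComponentIn_mem_nhds (hA.isOpen_compl.mem_nhds hx)] with y hy
      exact (hconst x hx y hy).symm
  refine ⟨⟨f, hcont⟩, hfA, fun x => ?_, hconst⟩
  by_cases hx : x ∈ A
  · exact ⟨x, hx, hfA x hx⟩
  · exact ⟨_, hpA x hx, hfC x hx⟩

/-- If `g y ≠ g z`, take connected neighbourhoods of `y` and `z` with disjoint images. Points of the
component in each of them already lie in one component of `Aᶜ` for some `A` in the chain, and the
frontier of that component meets both neighbourhoods. -/
theorem ConstOnFrontiers.sInter [LocallyConnectedSpace B] [T2Space X] {g : C(B, X)}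
    {c : Set (Set B)} (hc : IsChain (· ⊆ ·) c) (hclosed : ∀ A ∈ c, IsClosed A)
    (h : ∀ A ∈ c, ConstOnFrontiers g A) : ConstOnFrontiers g (⋂₀ c) := by
  intro x hx y hy z hz
  have hopen : IsOpen (⋂₀ c)ᶜ := (isClosed_sInter hclosed).isOpen_compl
  have hmem : ∀ y, y ∈ frontier (connectedComponentIn (⋂₀ c)ᶜ x) → y ∈ ⋂₀ c := fun y hy =>
    not_not.1 (notMem_of_mem_frontier_connectedComponentIn hopen hy)
  by_contra hne
  obtain ⟨O₁, O₂, hO₁, hO₂, hy₁, hz₂, hO⟩ := t2_separation hne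
  have hN₁ := connectedComponentIn_mem_nhds (g.continuous.continuousAt (hO₁.mem_nhds hy₁))
  have hN₂ := connectedComponentIn_mem_nhds (g.continuous.continuousAt (hO₂.mem_nhds hz₂))
  obtain ⟨p, hp₁, hp⟩ := mem_closure_iff_nhds.1 (frontier_subset_closure hy) _ hN₁
  obtain ⟨q, hq₂, hq⟩ := mem_closure_iff_nhds.1 (frontier_subset_closure hz) _ hN₂
  obtain ⟨A, hAc, hqA⟩ : ∃ A ∈ c, q ∈ connectedComponentIn Aᶜ p := by
    have hpc : p ∉ ⋂₀ c := connectedComponentIn_subset _ _ hp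
    -- The union on the right is open, and the chain condition makes it relatively closed in `(⋂₀
    -- c)ᶜ`.
    have key : connectedComponentIn (⋂₀ c)ᶜ p ⊆ ⋃ A ∈ c, connectedComponentIn Aᶜ p := by
      refine isPreconnected_connectedComponentIn.subset_of_closure_inter_subset
        (isOpen_biUnion fun A hA => (hclosed A hA).isOpen_compl.connectedComponentIn) ?_ ?_
      · obtain ⟨A, hA, hpA⟩ : ∃ A ∈ c, p ∉ A := by simpa using hpc
        exact ⟨p, mem_connectedComponentIn hpc,
          mem_biUnion hA (mem_connectedComponentIn hpA)⟩
      · rintro r ⟨hr, hr'⟩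
        obtain ⟨A, hA, hrA⟩ : ∃ A ∈ c, r ∉ A := by
          simpa using connectedComponentIn_subset _ _ hr'
        obtain ⟨s, hs, hs'⟩ := mem_closure_iff.1 hr _
          ((hclosed A hA).isOpen_compl.connectedComponentIn (x := r))
          (mem_connectedComponentIn hrA)
        obtain ⟨A', hA', hsA'⟩ := mem_iUnion₂.1 hs'
        obtain ⟨A'', hA'', hle, hle'⟩ : ∃ A'' ∈ c, A'' ⊆ A ∧ A'' ⊆ A' :=
          (hc.total hA hA').elim (fun hh => ⟨A, hA, Subset.rfl, hh⟩)
            fun hh => ⟨A', hA', hh, Subset.rfl⟩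
        refine mem_biUnion hA'' ?_
        rw [connectedComponentIn_eq (connectedComponentIn_mono p (compl_subset_compl.2 hle') hsA'),
          ← connectedComponentIn_eq (connectedComponentIn_mono r (compl_subset_compl.2 hle) hs)]
        exact mem_connectedComponentIn fun hm => hrA (hle hm)
    rw [← connectedComponentIn_eq hp] at key
    simpa using key hq
  have hpA : p ∈ connectedComponentIn Aᶜ p :=
    mem_connectedComponentIn (connectedComponentIn_nonempty_iff.1 ⟨q, hqA⟩)
  have hop := (hclosed A hAc).isOpen_compl.connectedComponentIn (x := p)
  obtain ⟨y', hy'N, hy'⟩ := isPreconnected_connectedComponentIn.inter_frontier_nonempty_of_isOpen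
    hop ⟨p, hp₁, hpA⟩ (mem_of_mem_nhds hN₁)
    (fun hm => connectedComponentIn_subset _ _ hm (hmem y hy A hAc))
  obtain ⟨z', hz'N, hz'⟩ := isPreconnected_connectedComponentIn.inter_frontier_nonempty_of_isOpen
    hop ⟨q, hq₂, hqA⟩ (mem_of_mem_nhds hN₂)
    (fun hm => connectedComponentIn_subset _ _ hm (hmem z hz A hAc))
  refine disjoint_left.1 hO (connectedComponentIn_subset (g ⁻¹' O₁) _ hy'N) ?_
  rw [h A hAc p (connectedComponentIn_subset _ _ hpA) y' hy' z' hz']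
  exact connectedComponentIn_subset (g ⁻¹' O₂) _ hz'N

end Collapse

/-! ### Arc coordinates -/

section Arc

/-- The coordinate of an open arc, extended by `0` to a map to the circle `ℝ / ℤ`. -/
theorem IsOpenArc.exists_coordinate {X : Type*} [TopologicalSpace X] [T2Space X] {ξ : Set X}
    (hξ : IsOpenArc ξ) :
    ∃ c : C(X, AddCircle (1 : ℝ)), (∀ x, c x = 0 ↔ x ∉ ξ) ∧ InjOn c ξ := by
  classical
  obtain ⟨hopen, ⟨φ⟩⟩ := hξ
  have : Fact ((0 : ℝ) < 1) := ⟨one_pos⟩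
  let f : X → AddCircle (1 : ℝ) := fun x =>
    if h : x ∈ ξ then (((φ ⟨x, h⟩ : Ioo (0 : ℝ) 1) : ℝ) : AddCircle (1 : ℝ)) else 0
  have hf : ∀ x (h : x ∈ ξ), f x = (((φ ⟨x, h⟩ : Ioo (0 : ℝ) 1) : ℝ) : AddCircle (1 : ℝ)) :=
    fun x h => dif_pos h
  have hf0 : ∀ x, x ∉ ξ → f x = 0 := fun x h => dif_neg h
  have hIco : ∀ t : Ioo (0 : ℝ) 1, (t : ℝ) ∈ Ico (0 : ℝ) (0 + 1) := fun t =>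
    ⟨t.2.1.le, by simpa using t.2.2⟩
  have hcont : Continuous f := by
    refine continuous_iff_continuousAt.2 fun x => ?_
    by_cases hx : x ∈ ξ
    · have : ContinuousOn f ξ := by
        rw [continuousOn_iff_continuous_domRestrict]
        have : ξ.domRestrict f = fun y => (((φ y : Ioo (0 : ℝ) 1) : ℝ) : AddCircle (1 : ℝ)) :=
          funext fun y => hf y y.2
        rw [this]
        exact (AddCircle.continuous_mk' 1).comp (continuous_subtype_val.comp φ.continuous)
      exact this.continuousAt (hopen.mem_nhds hx)
    · intro O hO
      rw [hf0 x hx] at hO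
      have hO' : ((↑) : ℝ → AddCircle (1 : ℝ)) ⁻¹' O ∈ 𝓝 (0 : ℝ) :=
        (AddCircle.continuous_mk' (1 : ℝ)).continuousAt (by simpa using hO)
      have hO'' : ((↑) : ℝ → AddCircle (1 : ℝ)) ⁻¹' O ∈ 𝓝 (1 : ℝ) :=
        (AddCircle.continuous_mk' (1 : ℝ)).continuousAt (by
          simpa [AddCircle.coe_period] using hO)
      obtain ⟨ε, hε, hball⟩ := Metric.mem_nhds_iff.1 hO'
      obtain ⟨δ, hδ, hball'⟩ := Metric.mem_nhds_iff.1 hO''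
      -- The middle of the arc is compact, hence closed as `X` is Hausdorff; off it the coordinate
      -- is near an end, so near `0` in `ℝ/ℤ`.
      have hK : IsCompact ((fun t : Ioo (0 : ℝ) 1 => ((φ.symm t : ξ) : X)) ''
          (((↑) : Ioo (0 : ℝ) 1 → ℝ) ⁻¹' Icc ε (1 - δ))) := by
        refine IsCompact.image ?_ (continuous_subtype_val.comp φ.symm.continuous)
        refine Topology.IsInducing.subtypeVal.isCompact_preimage_iff ?_ |>.2 isCompact_Icc
        rw [Subtype.range_coe]
        exact fun t ht => ⟨hε.trans_le ht.1, by linarith [ht.2]⟩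
      have hxK : x ∉ (fun t : Ioo (0 : ℝ) 1 => ((φ.symm t : ξ) : X)) ''
          (((↑) : Ioo (0 : ℝ) 1 → ℝ) ⁻¹' Icc ε (1 - δ)) := by
        rintro ⟨t, _, rfl⟩
        exact hx (φ.symm t).2
      rw [mem_map]
      filter_upwards [hK.isClosed.isOpen_compl.mem_nhds hxK]
        with y hy
      by_cases hyξ : y ∈ ξ
      · rw [mem_preimage, hf y hyξ]
        set t := φ ⟨y, hyξ⟩ with ht
        have hnot : (t : ℝ) ∉ Icc ε (1 - δ) := fun hm => hy ⟨t, hm, by simp [ht]⟩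
        by_cases h1 : (t : ℝ) < ε
        · exact hball (by rw [Metric.mem_ball, Real.dist_eq, abs_lt]; constructor <;> linarith [t.2.1])
        · have : 1 - δ < t := by
            by_contra h2
            exact hnot ⟨not_lt.1 h1, not_lt.1 h2⟩
          exact hball' (by rw [Metric.mem_ball, Real.dist_eq, abs_lt]; constructor <;> linarith [t.2.2])
      · rw [mem_preimage, hf0 y hyξ]
        exact mem_of_mem_nhds hO
  refine ⟨⟨f, hcont⟩, fun x => ⟨fun h hx => ?_, hf0 x⟩, fun x hx y hy hxy => ?_⟩
  · have h' : f x = 0 := h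
    rw [hf x hx, AddCircle.coe_eq_zero_iff_of_mem_Ico (by simpa using hIco (φ ⟨x, hx⟩))] at h'
    exact (φ ⟨x, hx⟩).2.1.ne' h'
  · have h' : f x = f y := hxy
    rw [hf x hx, hf y hy, AddCircle.coe_eq_coe_iff_of_mem_Ico (hIco _) (hIco _)] at h'
    exact congrArg Subtype.val (φ.injective (Subtype.ext h'))

end Arc

theorem AddCircle.eq_of_coe_eq_of_isPreconnected {B : Type*} [TopologicalSpace B] {C : Set B} (hC : IsPreconnected C) {F : C(B, ℝ)}
    {a : AddCircle (1 : ℝ)} (h : ∀ x ∈ C, (F x : AddCircle (1 : ℝ)) = a) {x y : B} (hx : x ∈ C)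
    (hy : y ∈ C) : F x = F y :=
  (AddCircle.isCoveringMap_coe (1 : ℝ)).constOn_of_comp hC F.continuous.continuousOn
    (fun z hz w hw => (h z hz).trans (h w hw).symm) hx hy

/-- Where `F` is not an integer, `h` lies in the arc and is determined by the value of `F`. -/
theorem eq_of_lift_eq {B X : Type*} [TopologicalSpace B] [TopologicalSpace X]
    {c : C(X, AddCircle (1 : ℝ))} {ξ : Set X} (hc : ∀ x, c x = 0 ↔ x ∉ ξ) (hinj : InjOn c ξ)
    {h : C(B, X)} {F : C(B, ℝ)}
    (hF : ∀ x, (F x : AddCircle (1 : ℝ)) = c (h x)) (y y' : B)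
    (hy : (F y : AddCircle (1 : ℝ)) ≠ 0) (hyy' : F y = F y') : h y = h y' := by
  have hy' : (F y' : AddCircle (1 : ℝ)) ≠ 0 := hyy' ▸ hy
  refine hinj (not_not.1 fun hn => hy ?_) (not_not.1 fun hn => hy' ?_) ?_
  · rw [hF, (hc _).2 hn]
  · rw [hF, (hc _).2 hn]
  · rw [← hF, ← hF, hyy']

/-! ### Positive and negative excursions of a lift -/

section Excursion

variable {B X : Type*} [TopologicalSpace B] [TopologicalSpace X] [T2Space X]

/-- By the intermediate value theorem on connected neighbourhoods, `F` takes every small positive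
value arbitrarily near both `w` and `w'`. Equal values of `F` force equal values of `h`, so `h w`
and `h w'` cannot be separated. -/
theorem eq_of_mem_frontier_pos [LocallyConnectedSpace B] {h : C(B, X)} {F : C(B, ℝ)}
    (hF : ∀ y y', (F y : AddCircle (1 : ℝ)) ≠ 0 → F y = F y' → h y = h y') {w w' : B}
    (hw : F w = 0) (hw' : F w' = 0) (hcl : w ∈ closure {x | 0 < F x})
    (hcl' : w' ∈ closure {x | 0 < F x}) : h w = h w' := by
  have key : ∀ (w : B) (O : Set X), IsOpen O → h w ∈ O → F w = 0 → w ∈ closure {x | 0 < F x} →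
      ∃ ε > 0, ∀ t, 0 < t → t ≤ ε → ∃ y, h y ∈ O ∧ F y = t := by
    intro w O hO hwO hw hcl
    have hN := connectedComponentIn_mem_nhds (h.continuous.continuousAt (hO.mem_nhds hwO))
    obtain ⟨x, hxN, hx⟩ := mem_closure_iff_nhds.1 hcl _ hN
    refine ⟨F x, hx, fun t ht htx => ?_⟩
    obtain ⟨y, hyN, hy⟩ := (isPreconnected_connectedComponentIn).intermediate_value
      (mem_of_mem_nhds hN) hxN F.continuous.continuousOn (show t ∈ Icc (F w) (F x) from
        ⟨by rw [hw]; exact ht.le, htx⟩)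
    exact ⟨y, connectedComponentIn_subset (h ⁻¹' O) _ hyN, hy⟩
  by_contra hne
  obtain ⟨O, O', hO, hO', hwO, hwO', hd⟩ := t2_separation hne
  obtain ⟨ε, hε, H⟩ := key w O hO hwO hw hcl
  obtain ⟨ε', hε', H'⟩ := key w' O' hO' hwO' hw' hcl'
  -- The bound `1 / 2` keeps the common value of `F` away from the next integer.
  have ht : 0 < min (min ε ε') (1 / 2) := by positivity
  obtain ⟨y, hyO, hy⟩ := H _ ht ((min_le_left _ _).trans (min_le_left _ _))
  obtain ⟨y', hyO', hy'⟩ := H' _ ht ((min_le_left _ _).trans (min_le_right _ _))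
  have hlt : F y < 1 := by
    rw [hy]
    exact (min_le_right _ _).trans_lt (by norm_num)
  have : Fact ((0 : ℝ) < 1) := ⟨one_pos⟩
  have hne0 : (F y : AddCircle (1 : ℝ)) ≠ 0 := by
    rw [Ne, AddCircle.coe_eq_zero_iff_of_mem_Ico ⟨hy ▸ ht.le, hlt⟩]
    exact hy ▸ ht.ne'
  exact disjoint_left.1 hd hyO (hF y y' hne0 (hy.trans hy'.symm) ▸ hyO')

theorem eq_of_mem_frontier_neg [LocallyConnectedSpace B] {h : C(B, X)} {F : C(B, ℝ)}
    (hF : ∀ y y', (F y : AddCircle (1 : ℝ)) ≠ 0 → F y = F y' → h y = h y') {w w' : B}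
    (hw : F w = 0) (hw' : F w' = 0) (hcl : w ∈ closure {x | F x < 0})
    (hcl' : w' ∈ closure {x | F x < 0}) : h w = h w' := by
  refine eq_of_mem_frontier_pos (F := -F) (fun y y' hy hyy' => hF y y' ?_ ?_) ?_ ?_ ?_ ?_ <;>
    simp_all

variable {c : C(X, AddCircle (1 : ℝ))} {ξ : Set X}

/-- On a component of the new complement, either `F` vanishes and the component is an old one, or
`F` has constant sign and the excursion lemmas apply. -/
theorem ConstOnFrontiers.inter_lift [LocallyConnectedSpace B] {g h : C(B, X)} {A : Set B}
    (hA : IsClosed A) (hgA : ConstOnFrontiers g A) (hh : EqOn h g A)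
    (hconst : ∀ x ∉ A, ∀ y ∈ connectedComponentIn Aᶜ x, h y = h x)
    (hc : ∀ x, c x = 0 ↔ x ∉ ξ) (hinj : InjOn c ξ) {F : C(B, ℝ)}
    (hF : ∀ x, (F x : AddCircle (1 : ℝ)) = c (h x)) :
    ConstOnFrontiers g (A ∩ {x | F x = 0}) := by
  set A' := A ∩ {x | F x = 0} with hA'
  have hA'c : IsClosed A' := hA.inter (isClosed_eq F.continuous continuous_const)
  have hFconst : ∀ x ∉ A, ∀ y ∈ connectedComponentIn Aᶜ x, F y = F x := fun x hx y hy =>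
    AddCircle.eq_of_coe_eq_of_isPreconnected isPreconnected_connectedComponentIn
      (fun z hz => by rw [hF, hconst x hx z hz]) hy (mem_connectedComponentIn hx)
  intro x hx y hy z hz
  have hfr : ∀ y ∈ frontier (connectedComponentIn A'ᶜ x), y ∈ A' := fun y hy =>
    not_not.1 (notMem_of_mem_frontier_connectedComponentIn hA'c.isOpen_compl hy)
  have hzero : IsOpen (interior {x | F x = 0}) := isOpen_interior
  -- A zero of `F` in this component lies off `A`, and `F` is constant on its component of `Aᶜ`,
  -- which is open.
  have hcov : connectedComponentIn A'ᶜ x ⊆ interior {x | F x = 0} ∪ {x | F x ≠ 0} := by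
    intro w hw
    by_cases hFw : F w = 0
    · left
      have hwA : w ∉ A := fun hwA => connectedComponentIn_subset _ _ hw ⟨hwA, hFw⟩
      refine mem_interior.2 ⟨connectedComponentIn Aᶜ w, fun v hv => ?_,
        hA.isOpen_compl.connectedComponentIn, mem_connectedComponentIn hwA⟩
      exact (hFconst w hwA v hv).trans hFw
    · exact Or.inr hFw
  have hxm : x ∈ connectedComponentIn A'ᶜ x := mem_connectedComponentIn hx
  have hval : ∀ y ∈ frontier (connectedComponentIn A'ᶜ x), F y = 0 ∧ g y = h y := fun y hy =>
    ⟨(hfr y hy).2, (hh (hfr y hy).1).symm⟩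
  have hopos : IsOpen {x | 0 < F x} := isOpen_lt continuous_const F.continuous
  have honeg : IsOpen {x | F x < 0} := isOpen_lt F.continuous continuous_const
  rcases isPreconnected_connectedComponentIn.subset_or_subset hzero
    (isOpen_ne_fun F.continuous continuous_const)
    (disjoint_left.2 fun w hw hw' => hw' (interior_subset (s := {x | F x = 0}) hw)) hcov with hsub | hsub
  · have hsubA : connectedComponentIn A'ᶜ x ⊆ Aᶜ := fun w hw hwA =>
      connectedComponentIn_subset _ _ hw ⟨hwA, interior_subset (hsub hw)⟩
    have heq : connectedComponentIn A'ᶜ x = connectedComponentIn Aᶜ x :=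
      (isPreconnected_connectedComponentIn.subset_connectedComponentIn hxm hsubA).antisymm
        (connectedComponentIn_mono x (compl_subset_compl.2 inter_subset_left))
    rw [heq] at hy hz
    exact hgA x (hsubA hxm) y hy z hz
  · rw [(hval y hy).2, (hval z hz).2]
    rcases isPreconnected_connectedComponentIn.subset_or_subset hopos honeg
      (disjoint_left.2 fun w hw hw' => lt_asymm (mem_ofPred.1 hw) (mem_ofPred.1 hw'))
      (fun w hw => (hsub hw).lt_or_gt.symm) with hs | hs
    · exact eq_of_mem_frontier_pos (eq_of_lift_eq hc hinj hF) (hval y hy).1 (hval z hz).1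
        (closure_mono hs (frontier_subset_closure hy))
        (closure_mono hs (frontier_subset_closure hz))
    · exact eq_of_mem_frontier_neg (eq_of_lift_eq hc hinj hF) (hval y hy).1 (hval z hz).1
        (closure_mono hs (frontier_subset_closure hy))
        (closure_mono hs (frontier_subset_closure hz))

/-- A map `g` can be changed away from `S` so that it meets an arc only where the lift of the arc
coordinate cannot be made to vanish on `S`. -/
theorem exists_eqOn_forall_lift_notMem [LocallyConnectedSpace B] [PreconnectedSpace B]
    (g : C(B, X)) {S : Set B} (hS : S.Nonempty) :
    ∃ h : C(B, X), EqOn h g S ∧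
      ∀ (ξ : Set X) (c : C(X, AddCircle (1 : ℝ))), (∀ x, c x = 0 ↔ x ∉ ξ) → InjOn c ξ →
        ∀ F : C(B, ℝ), (∀ x, (F x : AddCircle (1 : ℝ)) = c (h x)) → (∀ x ∈ S, F x = 0) →
          ∀ x, h x ∉ ξ := by
  obtain ⟨A, ⟨hA, hSA, hgA⟩, hmin⟩ := zorn_superset
    {A : Set B | IsClosed A ∧ S ⊆ A ∧ ConstOnFrontiers g A} (fun c hcS hc =>
      ⟨⋂₀ c, ⟨isClosed_sInter fun A hA => (hcS hA).1, subset_sInter fun A hA => (hcS hA).2.1,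
        ConstOnFrontiers.sInter hc (fun A hA => (hcS hA).1) fun A hA => (hcS hA).2.2⟩,
        fun A hA => sInter_subset_of_mem hA⟩)
  obtain ⟨h, hh, hrange, hconst⟩ := hgA.exists_collapse hA (hS.mono hSA)
  refine ⟨h, hh.mono hSA, fun ξ c hc hinj F hF hFS x hx => ?_⟩
  -- Minimality gives `F = 0` on `A`, and every value of `h` is attained on `A`.
  have hle := hmin ⟨hA.inter (isClosed_eq F.continuous continuous_const),
    subset_inter hSA hFS, hgA.inter_lift hA hh hconst hc hinj hF⟩ inter_subset_left
  obtain ⟨y, hyA, hy⟩ := hrange x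
  have hFy : F y = 0 := (hle hyA).2
  refine (hc (h y)).1 ?_ ?_
  · rw [← hF, hFy, AddCircle.coe_zero]
  · rwa [hh hyA, ← hy]

end Excursion

/-! ### Maps of discs -/

section Disc

theorem exists_lift_closedDisc (u : C(ClosedDisc, AddCircle (1 : ℝ))) :
    ∃ F : C(ClosedDisc, ℝ), ∀ x, (F x : AddCircle (1 : ℝ)) = u x := by
  have hconv : Convex ℝ (Metric.closedBall (0 : ℂ) 1) := convex_closedBall 0 1
  have : ContractibleSpace ClosedDisc := hconv.contractibleSpace ⟨0, by simp⟩
  have : LocallyPathConnectedSpace ClosedDisc := hconv.locallyPathConnectedSpace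
  obtain ⟨e, he⟩ := QuotientAddGroup.mk_surjective (u ⟨0, by simp⟩)
  obtain ⟨F, ⟨-, hF⟩, -⟩ :=
    (AddCircle.isCoveringMap_coe (1 : ℝ)).existsUnique_continuousMap_lifts u ⟨0, by simp⟩ e he
  exact ⟨F, fun x => congrFun hF x⟩

theorem isPreconnected_boundary_closedDisc : IsPreconnected {p : ClosedDisc | ‖(p : ℂ)‖ = 1} := by
  have : {p : ClosedDisc | ‖(p : ℂ)‖ = 1} =
      range fun z : Circle => (⟨z, by simp [Circle.norm_coe]⟩ : ClosedDisc) := by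
    ext p
    constructor
    · intro hp
      exact ⟨⟨p, mem_sphere_zero_iff_norm.2 hp⟩, rfl⟩
    · rintro ⟨z, rfl⟩
      exact Circle.norm_coe z
  rw [this]
  exact isPreconnected_range (by fun_prop)

variable {X : Type*} [TopologicalSpace X] [T2Space X] {arcs : Set (Set X)} {Z : Set X}

theorem exists_closedDisc_map_of_boundary_mem (harcs : ∀ ξ ∈ arcs, IsOpenArc ξ)
    (hZ : Z = (⋃₀ arcs)ᶜ) (g : C(ClosedDisc, X)) (hg : ∀ p : ClosedDisc, ‖(p : ℂ)‖ = 1 → g p ∈ Z) :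
    ∃ g' : C(ClosedDisc, Z), ∀ p : ClosedDisc, ‖(p : ℂ)‖ = 1 → (g' p : X) = g p := by
  have hconv : Convex ℝ (Metric.closedBall (0 : ℂ) 1) := convex_closedBall 0 1
  have : ContractibleSpace ClosedDisc := hconv.contractibleSpace ⟨0, by simp⟩
  have : LocallyPathConnectedSpace ClosedDisc := hconv.locallyPathConnectedSpace
  let p₀ : ClosedDisc := ⟨1, by simp⟩
  have hp₀ : ‖(p₀ : ℂ)‖ = 1 := by simp [p₀]
  obtain ⟨h, hS, H⟩ := exists_eqOn_forall_lift_notMem g (S := {p : ClosedDisc | ‖(p : ℂ)‖ = 1})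
    ⟨p₀, hp₀⟩
  have hhZ : ∀ x, h x ∈ Z := by
    rw [hZ]
    rintro x ⟨ξ, hξ, hx⟩
    obtain ⟨c, hc, hinj⟩ := (harcs ξ hξ).exists_coordinate
    obtain ⟨F, hF⟩ := exists_lift_closedDisc (c.comp h)
    have hF0 : ∀ p : ClosedDisc, ‖(p : ℂ)‖ = 1 → (F p : AddCircle (1 : ℝ)) = 0 := by
      intro p hp
      rw [hF, ContinuousMap.comp_apply, hc, hS hp]
      have := hg p hp
      rw [hZ] at this
      exact fun hm => this ⟨ξ, hξ, hm⟩
    -- On the connected boundary circle the lift is a constant integer, which is subtracted.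
    refine H ξ c hc hinj (F - ContinuousMap.const _ (F p₀)) (fun y => ?_) (fun y hy => ?_) x hx
    · simp [hF0 p₀ hp₀, hF y]
    · simp [AddCircle.eq_of_coe_eq_of_isPreconnected isPreconnected_boundary_closedDisc hF0
        hy hp₀]
  exact ⟨⟨fun x => ⟨h x, hhZ x⟩, by fun_prop⟩, fun p hp => hS hp⟩

end Disc

/-! ### Nullhomotopies as disc maps, and free homotopies -/

section Loops

open unitInterval

/-- The point `(1 - t) z` of the closed disc. -/
noncomputable def discPolar : C(I × Circle, ClosedDisc) where
  toFun q := ⟨((1 - (q.1 : ℝ) : ℝ) : ℂ) * q.2, by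
    rw [mem_closedBall_zero_iff, norm_mul, Complex.norm_real, Circle.norm_coe, mul_one,
      Real.norm_eq_abs, abs_of_nonneg (by linarith [q.1.2.2])]
    linarith [q.1.2.1]⟩
  continuous_toFun := by fun_prop

theorem coe_discPolar (q : I × Circle) :
    (discPolar q : ℂ) = ((1 - (q.1 : ℝ) : ℝ) : ℂ) * q.2 := rfl

theorem norm_discPolar (q : I × Circle) : ‖(discPolar q : ℂ)‖ = 1 - (q.1 : ℝ) := by
  rw [coe_discPolar, norm_mul, Complex.norm_real, Circle.norm_coe, mul_one, Real.norm_eq_abs,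
    abs_of_nonneg (by linarith [q.1.2.2])]

theorem discPolar_surjective : Function.Surjective discPolar := by
  intro p
  have hp : ‖(p : ℂ)‖ ≤ 1 := mem_closedBall_zero_iff.1 p.2
  refine ⟨(⟨1 - ‖(p : ℂ)‖, by linarith, by linarith [norm_nonneg (p : ℂ)]⟩,
    Circle.exp (Complex.arg p)), Subtype.ext ?_⟩
  rw [coe_discPolar, Circle.coe_exp, sub_sub_cancel, Complex.norm_mul_exp_arg_mul_I]

theorem eq_or_eq_one_of_discPolar_eq {q q' : I × Circle} (h : discPolar q = discPolar q') :
    q = q' ∨ (q.1 = 1 ∧ q'.1 = 1) := by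
  have h₁ : q.1 = q'.1 := by
    have := congrArg (fun p : ClosedDisc => ‖(p : ℂ)‖) h
    simp only [norm_discPolar] at this
    exact Subtype.ext (by linarith)
  by_cases hq : q.1 = 1
  · exact Or.inr ⟨hq, h₁ ▸ hq⟩
  · left
    refine Prod.ext h₁ (Circle.ext ?_)
    have := congrArg Subtype.val h
    rw [coe_discPolar, coe_discPolar, ← h₁] at this
    refine mul_left_cancel₀ ?_ this
    rw [Ne, Complex.ofReal_eq_zero, sub_eq_zero]
    exact fun he => hq (Subtype.ext he.symm)

theorem isQuotientMap_discPolar : IsQuotientMap discPolar :=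
  discPolar.continuous.isClosedMap.isQuotientMap discPolar.continuous discPolar_surjective

instance : LocallyPathConnectedSpace I := (convex_Icc (0 : ℝ) 1).locallyPathConnectedSpace

instance : LocallyPathConnectedSpace Circle :=
  (Circle.isCoveringMap_exp.isOpenMap.isQuotientMap Circle.exp.continuous
    Circle.exp_surjective).locallyPathConnectedSpace

variable {X : Type*} [TopologicalSpace X]

/-- `discPolar` is a quotient map identifying points only at time `1`, where the nullhomotopy is
constant. -/
theorem ContinuousMap.Nullhomotopic.exists_extend_closedDisc {γ : C(Circle, X)}
    (h : γ.Nullhomotopic) : ∃ g : C(ClosedDisc, X), ∀ z : Circle, g (discPolar (0, z)) = γ z := by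
  obtain ⟨x, ⟨H⟩⟩ := h
  have hfac : Function.FactorsThrough H.toContinuousMap discPolar := by
    rintro ⟨t, z⟩ ⟨t', z'⟩ hqq'
    rcases eq_or_eq_one_of_discPolar_eq hqq' with he | ⟨h₁, h₂⟩
    · rw [he]
    · obtain rfl : t = 1 := h₁
      obtain rfl : t' = 1 := h₂
      exact (H.apply_one z).trans (H.apply_one z').symm
  exact ⟨isQuotientMap_discPolar.lift H.toContinuousMap hfac, fun z =>
    (DFunLike.congr_fun (isQuotientMap_discPolar.lift_comp H.toContinuousMap hfac) (0, z)).trans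
      (H.apply_zero z)⟩

theorem ContinuousMap.nullhomotopic_of_closedDisc {γ : C(Circle, X)} (g : C(ClosedDisc, X))
    (h : ∀ z : Circle, g (discPolar (0, z)) = γ z) : γ.Nullhomotopic := by
  refine ⟨g ⟨0, by simp⟩, ⟨⟨g.comp discPolar, h, fun z => congrArg g (Subtype.ext ?_)⟩⟩⟩
  simp [coe_discPolar]

variable [T2Space X] {arcs : Set (Set X)} {Z : Set X}

theorem nullhomotopic_of_loopInAmbient (harcs : ∀ ξ ∈ arcs, IsOpenArc ξ) (hZ : Z = (⋃₀ arcs)ᶜ)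
    (γ : C(Circle, Z)) (h : (loopInAmbient γ).Nullhomotopic) : γ.Nullhomotopic := by
  obtain ⟨g, hg⟩ := h.exists_extend_closedDisc
  have hb : ∀ p : ClosedDisc, ‖(p : ℂ)‖ = 1 → ∃ z : Circle, discPolar (0, z) = p := by
    intro p hp
    exact ⟨⟨p, mem_sphere_zero_iff_norm.2 hp⟩, Subtype.ext (by simp [coe_discPolar])⟩
  obtain ⟨g', hg'⟩ := exists_closedDisc_map_of_boundary_mem harcs hZ g fun p hp => by
    obtain ⟨z, rfl⟩ := hb p hp
    rw [hg]
    exact (γ z).2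
  refine ContinuousMap.nullhomotopic_of_closedDisc g' fun z => Subtype.ext ?_
  rw [hg' _ (by simp [norm_discPolar]), hg]
  rfl

/-- `h` is constant on the frontier of `{F > 0}`, so it can be replaced by that constant on the
whole set, which contains the end of the cylinder at time `1` but misses the start. -/
theorem ContinuousMap.Homotopy.nullhomotopic_of_lift_pos {γ γ' : C(Circle, X)}
    (h : γ.Homotopy γ') {F : C(I × Circle, ℝ)}
    (hF : ∀ y y', (F y : AddCircle (1 : ℝ)) ≠ 0 → F y = F y' → h y = h y')
    (h₀ : ∀ z, F (0, z) = 0) (h₁ : ∀ z, 0 < F (1, z)) : γ.Nullhomotopic := by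
  classical
  have hfr : ∀ w ∈ frontier {q | 0 < F q}, F w = 0 := fun w hw =>
    (frontier_lt_subset_eq continuous_const F.continuous hw).symm
  obtain ⟨x, hx⟩ : ∃ x, ∀ w ∈ frontier {q | 0 < F q}, x = h w := by
    by_cases hne : (frontier {q | 0 < F q}).Nonempty
    · obtain ⟨w, hw⟩ := hne
      exact ⟨h w, fun w' hw' => eq_of_mem_frontier_pos (h := h.toContinuousMap) hF (hfr w hw)
        (hfr w' hw') (frontier_subset_closure hw) (frontier_subset_closure hw')⟩
    · exact ⟨h (0, 1), fun w hw => absurd ⟨w, hw⟩ hne⟩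
  refine ⟨x, ⟨⟨⟨fun q => if 0 < F q then x else h q,
    Continuous.if hx continuous_const h.continuous⟩, fun z => ?_, fun z => ?_⟩⟩⟩
  · simp [h₀]
  · simp [h₁]

theorem homotopic_of_loopInAmbient (harcs : ∀ ξ ∈ arcs, IsOpenArc ξ) (hZ : Z = (⋃₀ arcs)ᶜ)
    (γ γ' : C(Circle, Z)) (hγ : EssentialLoop γ)
    (h : (loopInAmbient γ).Homotopic (loopInAmbient γ')) : γ.Homotopic γ' := by
  obtain ⟨H⟩ := h
  obtain ⟨h, hS, hlift⟩ := exists_eqOn_forall_lift_notMem H.toContinuousMap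
    (S := {q : I × Circle | q.1 = 0 ∨ q.1 = 1}) ⟨(0, 1), Or.inl rfl⟩
  have h₀ : ∀ z, h (0, z) = γ z := fun z => (hS (Or.inl rfl)).trans (H.apply_zero z)
  have h₁ : ∀ z, h (1, z) = γ' z := fun z => (hS (Or.inr rfl)).trans (H.apply_one z)
  let h' : (loopInAmbient γ).Homotopy (loopInAmbient γ') := ⟨h, h₀, h₁⟩
  have hhZ : ∀ x, h x ∈ Z := by
    intro x
    by_contra hx
    rw [hZ, notMem_compl_iff] at hx
    obtain ⟨ξ, hξ, hx⟩ := hx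
    have hZξ : ∀ y : Z, (y : X) ∉ ξ := fun y hm =>
      hZ.subset y.2 ⟨ξ, hξ, hm⟩
    obtain ⟨c, hc, hinj⟩ := (harcs ξ hξ).exists_coordinate
    have hH₀ : ∀ z : Circle, c.comp h (0, z) = ((0 : C(Circle, ℝ)) z : AddCircle (1 : ℝ)) := by
      intro z
      rw [ContinuousMap.comp_apply, h₀, (hc _).2 (hZξ _)]
      simp
    let F := (AddCircle.isCoveringMap_coe (1 : ℝ)).liftHomotopy (c.comp h) 0 hH₀
    have hF : ∀ q, (F q : AddCircle (1 : ℝ)) = c (h q) := fun q => congrFun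
      ((AddCircle.isCoveringMap_coe (1 : ℝ)).liftHomotopy_lifts (c.comp h) 0 hH₀) q
    have hF₀ : ∀ z, F (0, z) = 0 := fun z =>
      (AddCircle.isCoveringMap_coe (1 : ℝ)).liftHomotopy_zero (c.comp h) 0 hH₀ z
    have hF₁ : ∀ z, F (1, z) = F (1, 1) := fun z =>
      AddCircle.eq_of_coe_eq_of_isPreconnected (a := 0)
        (isPreconnected_range (f := fun z : Circle => ((1 : I), z)) (by fun_prop))
        (by rintro _ ⟨w, rfl⟩; rw [hF, h₁, (hc _).2 (hZξ _)]) ⟨z, rfl⟩ ⟨1, rfl⟩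
    have hFeq := eq_of_lift_eq hc hinj hF
    refine hγ (nullhomotopic_of_loopInAmbient harcs hZ γ ?_)
    -- A nonzero end value makes `γ` nulhomotopic in `X`; a zero one makes `F` vanish on both ends,
    -- so `h` misses `ξ`.
    rcases lt_trichotomy (F (1, 1)) 0 with hk | hk | hk
    · refine ContinuousMap.Homotopy.nullhomotopic_of_lift_pos h' (F := -F)
        (fun y y' hy hyy' => hFeq y y' ?_ ?_) (fun z => ?_) (fun z => ?_)
      · simpa using hy
      · simpa using hyy'
      · simp [hF₀]
      · simpa [hF₁] using hk
    · refine absurd hx (hlift ξ c hc hinj F hF ?_ x)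
      rintro ⟨t, z⟩ (rfl | rfl)
      · exact hF₀ z
      · exact (hF₁ z).trans hk
    · exact ContinuousMap.Homotopy.nullhomotopic_of_lift_pos h' hFeq hF₀
        fun z => (hF₁ z).symm ▸ hk
  exact ⟨⟨⟨fun q => ⟨h q, hhZ q⟩, by fun_prop⟩, fun z => Subtype.ext (h₀ z),
    fun z => Subtype.ext (h₁ z)⟩⟩

end Loops

theorem mainTheorem1 {X : Type*} [TopologicalSpace X] [T2Space X]
    (arcs : Set (Set X)) (harcs : ∀ ξ ∈ arcs, IsOpenArc ξ)
    (hdisj : arcs.PairwiseDisjoint id)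
    (Z : Set X) (hZ : Z = (⋃₀ arcs)ᶜ) :
    -- (1), for maps of discs
    (∀ g : C(ClosedDisc, X), (∀ p : ClosedDisc, ‖(p : ℂ)‖ = 1 → g p ∈ Z) →
      ∃ g' : C(ClosedDisc, Z), ∀ p : ClosedDisc, ‖(p : ℂ)‖ = 1 → (g' p : X) = g p) ∧
    -- (1), for loops
    (∀ γ : C(Circle, Z), (loopInAmbient γ).Nullhomotopic → γ.Nullhomotopic) ∧
    -- (2)
    (∀ γ γ' : C(Circle, Z), EssentialLoop γ → EssentialLoop γ' →
      (loopInAmbient γ).Homotopic (loopInAmbient γ') → γ.Homotopic γ') :=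
  ⟨exists_closedDisc_map_of_boundary_mem harcs hZ, nullhomotopic_of_loopInAmbient harcs hZ,
    fun γ γ' hγ _ => homotopic_of_loopInAmbient harcs hZ γ γ' hγ⟩
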